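/- Let $\Sigma$ be a propositional vocabulary (a set of atoms) and $\mathcal{A}$ a set of agents. All ordinals are countable. **Prebiworlds and restriction**, by simultaneous transfinite recursion. A $0$-prebiworld is an interpretation $\mathcal{I}\subseteq\Sigma$. A $(\mu+1)$-prebiworld $w$ is a triple $(\mathcal{I},(A^w)_{A\in\mathcal{A}},(\bar A^w)_{A\in\mathcal{A}})$, where $\mathcal{I}$ is an interpretation and $A^w,\bar A^w$ are sets of $\mu$-prebiworlds. For a limit ordinal $\lambda$, a $\lambda$-prebiworld is a sequence $w=(w_\alpha)_{\alpha<\lambda}$ in which $w_\alpha$ is an $\alpha$-prebiworld and $w_\gamma\leq_p w_\alpha$ for all $\gamma\leq\alpha<\lambda$. The objective interpretation $\mathrm{obj}(w)$ is $\mathcal{I}$ in the first two cases and $w_0$ in the third. For a $\mu$-prebiworld $w$ and $\alpha\leq\mu$, the restriction $w|_\alpha$ is the $\alpha$-prebiworld given by: $w|_0=\mathrm{obj}(w)$; $w|_\alpha=(w|_\gamma)_{\gamma<\alpha}$ if $\alpha$ is a limit; if $\alpha=\alpha'+1$ and $\mu$ is a limit, $w|_\alpha=w_\alpha$; if $\alpha=\alpha'+1$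 and $\mu=\mu'+1$, then $w|_\alpha$ has objective interpretation $\mathrm{obj}(w)$ and, for each agent $A$, $A^{w|_\alpha}=\{x|_{\alpha'} : x\in A^w\}$ and $\bar A^{w|_\alpha}=\{x|_{\alpha'} : x\in\bar A^w\}$. For an $\alpha$-prebiworld $v$ and a $\mu$-prebiworld $w$ with $\alpha\leq\mu$, write $v\leq_p w$ (equivalently $w\geq_p v$; $w$ is an extension of $v$) if $w|_\alpha=v$. **Biworlds and completedness**, by simultaneous transfinite recursion. Every $0$-prebiworld is a $0$-biworld. A $\lambda$-prebiworld $w$, $\lambda$ a limit, is a $\lambda$-biworld if $w_\alpha$ is an $\alpha$-biworld for each $\alpha<\lambda$. Given the set of $\mu$-biworlds, the sets of incompleted $\mu$-prebiworlds and of $(\mu+1)$-biworlds are the least sets such that: a $\mu$-prebiworld $w$ is incompleted iff there are two distinct $(\mu+1)$-biworlds $v_1,v_2\geq_p w$; and a $(\mu+1)$-prebiworld $w$ is a $(\mu+1)$-biworld iff for every agent $A$, $A^w\cup\bar A^w$ is the set of all $\mu$-biworlds and every element of $A^w\cap\bar A^w$ is incompleted. A prebiworld is completed if it is not incompleted. **Theorem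 1.** Let $\alpha\leq\mu'\leq\mu<\beta$ be countable ordinals, let $w$ be a $\mu$-biworld and $w'$ a $\mu'$-biworld. Then: 1. The restriction $w|_\alpha$ is an $\alpha$-biworld. 2. If $w'$ is completed and $w\geq_p w'$, then $w$ is completed. 3. There exists a completed $\beta$-biworld $v$ with $v\geq_p w$. 4. If $\mu$ is a successor ordinal, then $w$ is completed if and only if $A^w\cap\bar A^w=\emptyset$ for every agent $A\in\mathcal{A}$. -/

import Mathlib

universe u v

namespace Biworld

open Order

/-- An interpretation of the propositional vocabulary `S`: the set of atoms that are true in it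
(lifted to the universe in which all prebiworlds live). -/
abbrev Interp (S : Type u) : Type (max u v 1) := ULift.{max v 1} (Set S)

/-- The data of a prebiworld of depth `α + 1`, where `T` is the type for depth `α`: an objective
interpretation and, for each agent `A`, the two sets `A^w` (`poss`) and `Ā^w` (`imposs`). -/
structure Node (S : Type u) (Ag : Type v) (T : Type (max u v 1)) : Type (max u v 1) where
  obj : Interp.{u, v} S
  poss : Ag → Set T
  imposs : Ag → Set T

/-- Raw prebiworlds of depth `α`. They differ from prebiworlds only in that the sequences used at
limit depths need not be increasing for the precision order; `IsPrebiworld` below requires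
this (hereditarily). Restriction makes sense on raw prebiworlds, so the simultaneous recursion that
defines prebiworlds and their restrictions can be split. -/
noncomputable def Raw (S : Type u) (Ag : Type v) (α : Ordinal.{0}) : Type (max u v 1) :=
  Ordinal.limitRecOn (motive := fun _ => Type (max u v 1)) α
    (Interp.{u, v} S)
    (fun _ T => Node S Ag T)
    (fun l _ T => ∀ β : Ordinal.{0}, ∀ h : β < l, T β h)

variable {S : Type u} {Ag : Type v}

/-- Depth `0`: interpretations. -/
noncomputable def zeroEquiv : Raw S Ag 0 ≃ Interp.{u, v} S :=
  Equiv.cast (by rw [Raw, Ordinal.limitRecOn_zero])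

/-- Depth `α + 1`: triples. -/
noncomputable def succEquiv (α : Ordinal.{0}) : Raw S Ag (α + 1) ≃ Node S Ag (Raw S Ag α) :=
  Equiv.cast (by rw [Raw, Ordinal.limitRecOn_add_one]; rfl)

/-- Limit depth: transfinite sequences. -/
noncomputable def limitEquiv {l : Ordinal.{0}} (hl : IsSuccLimit l) :
    Raw S Ag l ≃ (∀ β : Ordinal.{0}, β < l → Raw S Ag β) :=
  Equiv.cast (by rw [Raw, Ordinal.limitRecOn_limit _ _ _ _ hl]; rfl)

/-- `A^w`, for `w` of depth `α + 1`. -/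
noncomputable def poss {α : Ordinal.{0}} (w : Raw S Ag (α + 1)) (A : Ag) : Set (Raw S Ag α) :=
  (succEquiv α w).poss A

/-- `Ā^w`, for `w` of depth `α + 1`. -/
noncomputable def imposs {α : Ordinal.{0}} (w : Raw S Ag (α + 1)) (A : Ag) : Set (Raw S Ag α) :=
  (succEquiv α w).imposs A

/-- `(w)_β`, for `w` of limit depth `l` and `β < l`. -/
noncomputable def component {l : Ordinal.{0}} (hl : IsSuccLimit l) (w : Raw S Ag l)
    {β : Ordinal.{0}} (hβ : β < l) : Raw S Ag β :=
  limitEquiv hl w β hβ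

/-- The objective interpretation of `w`, of any depth. -/
noncomputable def obj {α : Ordinal.{0}} : Raw S Ag α → Interp.{u, v} S :=
  Ordinal.limitRecOn (motive := fun α => Raw S Ag α → Interp.{u, v} S) α
    (fun w => zeroEquiv w)
    (fun α _ w => (succEquiv α w).obj)
    (fun _ hl _ w => zeroEquiv (component hl w hl.bot_lt))

/-- The restriction of `w` to a successor depth `β + 1`, given the restriction to `β` of all
objects of depth at least `β`. -/
noncomputable def restrSucc {β : Ordinal.{0}}
    (r : ∀ α : Ordinal.{0}, β ≤ α → Raw S Ag α → Raw S Ag β) (α : Ordinal.{0}) :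
    β + 1 ≤ α → Raw S Ag α → Raw S Ag (β + 1) :=
  Ordinal.limitRecOn (motive := fun α => β + 1 ≤ α → Raw S Ag α → Raw S Ag (β + 1)) α
    (fun h => absurd h (by simp))
    (fun α' _ h w => (succEquiv β).symm
      { obj := obj w
        poss := fun A => r α' (by simpa using h) '' poss w A
        imposs := fun A => r α' (by simpa using h) '' imposs w A })
    (fun _ hl _ h w => component hl w (lt_of_le_of_ne h fun e => hl.succ_ne β e))

/-- The restriction of `w` to depth `β`, by recursion on `β`; see the equations
`restrict_zero`, `restrict_limit`, `restrict_succ_limit` and `restrict_succ_succ`. -/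
noncomputable def restrictAux (β : Ordinal.{0}) :
    ∀ α : Ordinal.{0}, β ≤ α → Raw S Ag α → Raw S Ag β :=
  Ordinal.limitRecOn (motive := fun β => ∀ α : Ordinal.{0}, β ≤ α → Raw S Ag α → Raw S Ag β) β
    (fun _ _ w => zeroEquiv.symm (obj w))
    (fun _ r => restrSucc r)
    (fun _ hl r α h w => (limitEquiv hl).symm fun γ hγ => r γ hγ α (hγ.le.trans h) w)

/-- The restriction `w|_β` of `w` of depth `α` to a depth `β ≤ α`. -/
noncomputable def restrict {α β : Ordinal.{0}} (h : β ≤ α) (w : Raw S Ag α) : Raw S Ag β :=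
  restrictAux β α h w

theorem obj_zero (w : Raw S Ag 0) : obj w = zeroEquiv w := by
  simp [obj]

theorem obj_succ {α : Ordinal.{0}} (w : Raw S Ag (α + 1)) : obj w = (succEquiv α w).obj := by
  simp [obj]

theorem obj_limit {l : Ordinal.{0}} (hl : IsSuccLimit l) (w : Raw S Ag l) :
    obj w = zeroEquiv (component hl w hl.bot_lt) := by
  rw [obj, Ordinal.limitRecOn_limit _ _ _ _ hl]

theorem restrict_zero {α : Ordinal.{0}} (h : 0 ≤ α) (w : Raw S Ag α) :
    restrict h w = zeroEquiv.symm (obj w) := by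
  simp [restrict, restrictAux]

theorem restrict_limit {α l : Ordinal.{0}} (hl : IsSuccLimit l) (h : l ≤ α) (w : Raw S Ag α) :
    restrict h w = (limitEquiv hl).symm fun _ hγ => restrict (hγ.le.trans h) w := by
  rw [restrict, restrictAux, Ordinal.limitRecOn_limit _ _ _ _ hl]; rfl

theorem restrict_succ_limit {β l : Ordinal.{0}} (hl : IsSuccLimit l) (h : β + 1 < l)
    (w : Raw S Ag l) : restrict h.le w = component hl w h := by
  rw [restrict, restrictAux, Ordinal.limitRecOn_add_one, restrSucc,
    Ordinal.limitRecOn_limit _ _ _ _ hl]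

theorem restrict_succ_succ {α β : Ordinal.{0}} (h : β ≤ α) (h' : β + 1 ≤ α + 1)
    (w : Raw S Ag (α + 1)) :
    restrict h' w = (succEquiv β).symm
      { obj := obj w
        poss := fun A => restrict h '' poss w A
        imposs := fun A => restrict h '' imposs w A } := by
  rw [restrict, restrictAux, Ordinal.limitRecOn_add_one, restrSucc, Ordinal.limitRecOn_add_one]
  rfl

/-- The precision order `v ≤ₚ w`: `v` is a restriction of `w`, and `w` an extension of `v`. -/
def LePrec {β α : Ordinal.{0}} (v : Raw S Ag β) (w : Raw S Ag α) : Prop :=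
  ∃ h : β ≤ α, restrict h w = v

/-- `w` is a prebiworld: all its members or components are, and at limit depths the sequence is
increasing for the precision order. -/
noncomputable def IsPrebiworld {α : Ordinal.{0}} : Raw S Ag α → Prop :=
  Ordinal.limitRecOn (motive := fun α => Raw S Ag α → Prop) α
    (fun _ => True)
    (fun _ P w => ∀ A, (∀ x ∈ poss w A, P x) ∧ (∀ x ∈ imposs w A, P x))
    (fun l hl P w =>
      (∀ β (hβ : β < l), P β hβ (component hl w hβ)) ∧
      ∀ β γ (hβ : β < l) (hγ : γ ≤ β),
        LePrec (component hl w (hγ.trans_lt hβ)) (component hl w hβ))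

theorem isPrebiworld_zero (w : Raw S Ag 0) : IsPrebiworld w := by
  simp [IsPrebiworld]

theorem isPrebiworld_succ {α : Ordinal.{0}} (w : Raw S Ag (α + 1)) :
    IsPrebiworld w ↔
      ∀ A, (∀ x ∈ poss w A, IsPrebiworld x) ∧ (∀ x ∈ imposs w A, IsPrebiworld x) := by
  rw [IsPrebiworld, Ordinal.limitRecOn_add_one]; rfl

theorem isPrebiworld_limit {l : Ordinal.{0}} (hl : IsSuccLimit l) (w : Raw S Ag l) :
    IsPrebiworld w ↔
      (∀ β (hβ : β < l), IsPrebiworld (component hl w hβ)) ∧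
      ∀ β γ (hβ : β < l) (hγ : γ ≤ β),
        LePrec (component hl w (hγ.trans_lt hβ)) (component hl w hβ) := by
  rw [IsPrebiworld, Ordinal.limitRecOn_limit _ _ _ _ hl]; rfl

mutual

/-- Given the set `B` of biworlds of depth `α`, the incompleted prebiworlds of depth `α`, defined
simultaneously with the biworlds of depth `α + 1` as the least pair of predicates satisfying their
defining conditions. -/
inductive IncompletedStep (α : Ordinal.{0}) (B : Set (Raw S Ag α)) : Raw S Ag α → Prop
  | intro (w : Raw S Ag α) (v₁ v₂ : Raw S Ag (α + 1)) :
      SuccStep α B v₁ → SuccStep α B v₂ → v₁ ≠ v₂ → LePrec w v₁ → LePrec w v₂ →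
      IncompletedStep α B w

/-- Given the set `B` of biworlds of depth `α`, the biworlds of depth `α + 1`. -/
inductive SuccStep (α : Ordinal.{0}) (B : Set (Raw S Ag α)) : Raw S Ag (α + 1) → Prop
  | intro (w : Raw S Ag (α + 1)) :
      IsPrebiworld w →
      (∀ A, poss w A ∪ imposs w A = B) →
      (∀ A, ∀ x ∈ poss w A ∩ imposs w A, IncompletedStep α B x) →
      SuccStep α B w

end

/-- The set of biworlds of depth `α`. -/
noncomputable def biworlds (α : Ordinal.{0}) : Set (Raw S Ag α) :=
  Ordinal.limitRecOn (motive := fun α => Set (Raw S Ag α)) α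
    Set.univ
    (fun α B => {w | SuccStep α B w})
    (fun l hl B => {w | IsPrebiworld w ∧ ∀ β (hβ : β < l), component hl w hβ ∈ B β hβ})

/-- `w` is a biworld. -/
def IsBiworld {α : Ordinal.{0}} (w : Raw S Ag α) : Prop :=
  w ∈ biworlds α

/-- `w` is incompleted, i.e. it has two distinct extensions among the biworlds of the next depth
(see `incompleted_iff`). -/
def Incompleted {α : Ordinal.{0}} (w : Raw S Ag α) : Prop :=
  IncompletedStep α (biworlds α) w

/-- `w` is completed. -/
def Completed {α : Ordinal.{0}} (w : Raw S Ag α) : Prop :=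
  ¬ Incompleted w

theorem isBiworld_zero (w : Raw S Ag 0) : IsBiworld w := by
  simp [IsBiworld, biworlds]

theorem isBiworld_succ_iff_step {α : Ordinal.{0}} (w : Raw S Ag (α + 1)) :
    IsBiworld w ↔ SuccStep α (biworlds α) w := by
  rw [IsBiworld, biworlds, Ordinal.limitRecOn_add_one]; rfl

theorem isBiworld_succ {α : Ordinal.{0}} (w : Raw S Ag (α + 1)) :
    IsBiworld w ↔ IsPrebiworld w ∧
      (∀ A, poss w A ∪ imposs w A = {x | IsBiworld x}) ∧
      ∀ A, ∀ x ∈ poss w A ∩ imposs w A, Incompleted x := by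
  rw [isBiworld_succ_iff_step]
  exact ⟨fun ⟨_, h₁, h₂, h₃⟩ => ⟨h₁, h₂, h₃⟩, fun ⟨h₁, h₂, h₃⟩ => ⟨_, h₁, h₂, h₃⟩⟩

theorem isBiworld_limit {l : Ordinal.{0}} (hl : IsSuccLimit l) (w : Raw S Ag l) :
    IsBiworld w ↔ IsPrebiworld w ∧ ∀ β (hβ : β < l), IsBiworld (component hl w hβ) := by
  rw [IsBiworld, biworlds, Ordinal.limitRecOn_limit _ _ _ _ hl]; rfl

theorem incompleted_iff {α : Ordinal.{0}} (w : Raw S Ag α) :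
    Incompleted w ↔ ∃ v₁ v₂ : Raw S Ag (α + 1),
      IsBiworld v₁ ∧ IsBiworld v₂ ∧ v₁ ≠ v₂ ∧ LePrec w v₁ ∧ LePrec w v₂ := by
  simp only [isBiworld_succ_iff_step]
  exact ⟨fun ⟨_, v₁, v₂, h₁, h₂, h₃, h₄, h₅⟩ => ⟨v₁, v₂, h₁, h₂, h₃, h₄, h₅⟩,
    fun ⟨v₁, v₂, h₁, h₂, h₃, h₄, h₅⟩ => ⟨_, v₁, v₂, h₁, h₂, h₃, h₄, h₅⟩⟩

end Biworld

-- The proof is an induction on depth for the three clauses of `Regular`: biworlds restrict to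
-- biworlds, smaller biworlds extend up to the given depth, and every biworld has a next-level
-- extension with disjoint sides.
--
-- Disjoint sides at one depth decide everything above it. An element of a later side restricts to
-- exactly one of the disjoint sides, so its own side is forced (`completed_of_disj_restrict`).
-- Hence completedness is inherited by extensions and a completed biworld has at most one extension
-- of each depth (`Regular.completed`, `eq_of_restrict_completed`). Conversely, an element on both
-- sides is incompleted, so it has two extensions; choosing which of them to make negative yields
-- two different extensions of the whole biworld (`Completed.disj`).
--
-- The main difficulty is the disjoint extension, whose sides must still restrict onto the old ones.
-- At successor depth, an element on both sides has two extensions, one for each side (`split`). At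
-- limit depth the elements are branches, and a branch on both sides must be allotted without
-- emptying either side above any smaller element (`limitSplit`). Countability enters only here:
-- `exists_branch` climbs a cofinal sequence of type ω while remaining on one side.

namespace Biworld

open Order

variable {S : Type u} {Ag : Type v}

-- Sides, extensionality and computation of restrictions.

/-- The sets `A^w` (for `true`) and `Ā^w` (for `false`). -/
noncomputable def side (b : Bool) {α : Ordinal.{0}} (w : Raw S Ag (α + 1)) (A : Ag) :
    Set (Raw S Ag α) :=
  cond b (poss w A) (imposs w A)

/-- The raw prebiworld of successor depth with given objective interpretation and sides. -/
noncomputable def mkSucc {α : Ordinal.{0}} (o : Interp.{u, v} S)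
    (s : Bool → Ag → Set (Raw S Ag α)) : Raw S Ag (α + 1) :=
  (succEquiv α).symm ⟨o, s true, s false⟩

@[simp] theorem obj_mkSucc {α : Ordinal.{0}} (o : Interp.{u, v} S)
    (s : Bool → Ag → Set (Raw S Ag α)) : obj (mkSucc o s) = o := by
  simp [obj_succ, mkSucc]

@[simp] theorem side_mkSucc {α : Ordinal.{0}} (o : Interp.{u, v} S)
    (s : Bool → Ag → Set (Raw S Ag α)) (b : Bool) (A : Ag) : side b (mkSucc o s) A = s b A := by
  cases b <;> simp [side, poss, imposs, mkSucc]

theorem raw_succ_ext {α : Ordinal.{0}} {v w : Raw S Ag (α + 1)} (ho : obj v = obj w)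
    (hs : ∀ b A, side b v A = side b w A) : v = w := by
  apply (succEquiv α).injective
  rw [obj_succ, obj_succ] at ho
  have h1 : (succEquiv α v).poss = (succEquiv α w).poss := funext (hs true)
  have h2 : (succEquiv α v).imposs = (succEquiv α w).imposs := funext (hs false)
  generalize succEquiv α v = a at *
  generalize succEquiv α w = b at *
  cases a; cases b; simp_all

theorem raw_limit_ext {l : Ordinal.{0}} (hl : IsSuccLimit l) {v w : Raw S Ag l}
    (h : ∀ β (hβ : β < l), component hl v hβ = component hl w hβ) : v = w := by
  apply (limitEquiv hl).injective
  funext β hβ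
  exact h β hβ

@[simp] theorem component_limitEquiv_symm {l : Ordinal.{0}} (hl : IsSuccLimit l)
    (f : ∀ β : Ordinal.{0}, β < l → Raw S Ag β) {β : Ordinal.{0}} (hβ : β < l) :
    component hl ((limitEquiv hl).symm f) hβ = f β hβ := by
  simp [component]

theorem component_restrict {α l : Ordinal.{0}} (hl : IsSuccLimit l) (h : l ≤ α) (w : Raw S Ag α)
    {γ : Ordinal.{0}} (hγ : γ < l) :
    component hl (restrict h w) hγ = restrict (hγ.le.trans h) w := by
  rw [restrict_limit hl, component_limitEquiv_symm]

theorem restrict_succ_succ_eq {α β : Ordinal.{0}} (h : β ≤ α) (h' : β + 1 ≤ α + 1)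
    (w : Raw S Ag (α + 1)) :
    restrict h' w = mkSucc (obj w) fun b A => restrict h '' side b w A := by
  rw [restrict_succ_succ h]; rfl

@[simp] theorem obj_restrict_succ_succ {α β : Ordinal.{0}} (h' : β + 1 ≤ α + 1)
    (w : Raw S Ag (α + 1)) : obj (restrict h' w) = obj w := by
  rw [restrict_succ_succ_eq (by simpa using h')]; simp

theorem side_restrict_succ_succ {α β : Ordinal.{0}} (h : β ≤ α) (h' : β + 1 ≤ α + 1)
    (w : Raw S Ag (α + 1)) (b : Bool) (A : Ag) :
    side b (restrict h' w) A = restrict h '' side b w A := by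
  rw [restrict_succ_succ_eq h]; simp

-- Restriction of prebiworlds.

theorem isPrebiworld_succ_side {α : Ordinal.{0}} (w : Raw S Ag (α + 1)) :
    IsPrebiworld w ↔ ∀ b A, ∀ x ∈ side b w A, IsPrebiworld x := by
  rw [isPrebiworld_succ]
  simp [side, forall_and, and_comm]

theorem obj_restrict_succ {α δ : Ordinal.{0}} (h : δ ≤ α + 1) (w : Raw S Ag (α + 1)) :
    obj (restrict h w) = obj w := by
  induction δ using Ordinal.limitRecOn with
  | zero => rw [restrict_zero, obj_zero]; simp
  | add_one δ _ => simp
  | limit l hl _ => rw [obj_limit hl, component_restrict, restrict_zero]; simp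

/-- Below a limit, the definition identifies restriction with component only at successor depths. At
a limit depth `m` the identification rests on the coherence clause, which raw sequences may violate.
-/
theorem restrict_eq_component_and_self {α : Ordinal.{0}} (w : Raw S Ag α) (hw : IsPrebiworld w) :
    restrict le_rfl w = w ∧
      ∀ (hl : IsSuccLimit α) (δ : Ordinal.{0}) (hδ : δ < α),
        restrict hδ.le w = component hl w hδ := by
  induction α using Ordinal.limitRecOn with
  | zero => exact ⟨by simp [restrict_zero, obj_zero], fun hl => by simp at hl⟩
  | add_one α ih =>
    refine ⟨?_, fun hl => (hl.succ_ne α rfl).elim⟩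
    rw [isPrebiworld_succ_side] at hw
    refine raw_succ_ext (by simp) fun b A => ?_
    rw [side_restrict_succ_succ le_rfl]
    conv_rhs => rw [← Set.image_id (side b w A)]
    exact Set.image_congr fun x hx => (ih x (hw b A x hx)).1
  | limit l hl ih =>
    rw [isPrebiworld_limit hl] at hw
    have key : ∀ (δ : Ordinal.{0}) (hδ : δ < l), restrict hδ.le w = component hl w hδ := by
      intro δ
      induction δ using Ordinal.limitRecOn with
      | zero => intro hδ; rw [restrict_zero, obj_limit hl]; simp
      | add_one δ _ => intro hδ; exact restrict_succ_limit hl hδ w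
      | limit m hm ihm =>
        intro hδ
        refine raw_limit_ext hm fun γ hγ => ?_
        -- By coherence and the induction hypothesis at `m`, the `γ`-component of the `m`-component
        -- of `w` is the `γ`-component of `w`.
        rw [component_restrict, ihm γ hγ (hγ.trans hδ), ← (ih m hδ _ (hw.1 m hδ)).2 hm γ hγ]
        exact (hw.2 m γ hδ hγ.le).2.symm
    refine ⟨raw_limit_ext hl fun γ hγ => ?_, fun _ => key⟩
    rw [component_restrict, key γ hγ]

theorem IsPrebiworld.restrict_self {α : Ordinal.{0}} {w : Raw S Ag α} (hw : IsPrebiworld w)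
    (h : α ≤ α) : restrict h w = w :=
  (restrict_eq_component_and_self w hw).1

theorem IsPrebiworld.restrict_eq_component {l : Ordinal.{0}} {w : Raw S Ag l} (hw : IsPrebiworld w)
    (hl : IsSuccLimit l) {δ : Ordinal.{0}} (hδ : δ < l) (h : δ ≤ l) :
    restrict h w = component hl w hδ :=
  (restrict_eq_component_and_self w hw).2 hl δ hδ

/-- At a limit top depth this is the coherence clause itself; at a successor it passes to the
members as an image of an image. -/
theorem IsPrebiworld.restrict_restrict {α δ γ : Ordinal.{0}} {w : Raw S Ag α}
    (hw : IsPrebiworld w) (hδ : δ ≤ α) (hγ : γ ≤ δ) :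
    restrict hγ (restrict hδ w) = restrict (hγ.trans hδ) w := by
  induction α using Ordinal.limitRecOn generalizing δ γ with
  | zero =>
    obtain rfl : δ = 0 := le_antisymm hδ (zero_le)
    obtain rfl : γ = 0 := le_antisymm hγ (zero_le)
    rw [hw.restrict_self, hw.restrict_self]
  | limit l hl ih =>
    rcases hδ.eq_or_lt with rfl | h
    · rw [hw.restrict_self]
    · rw [hw.restrict_eq_component hl h, hw.restrict_eq_component hl (hγ.trans_lt h)]
      exact (((isPrebiworld_limit hl w).1 hw).2 δ γ h hγ).2
  | add_one α ih =>
    have hw' := (isPrebiworld_succ_side w).1 hw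
    induction γ using Ordinal.limitRecOn with
    | zero => rw [restrict_zero, restrict_zero, obj_restrict_succ]
    | limit m hm ihm =>
      refine raw_limit_ext hm fun η hη => ?_
      rw [component_restrict, component_restrict, ihm η hη]
    | add_one γ _ =>
      cases δ using Ordinal.limitRecOn with
      | zero => exact absurd hγ (by simp)
      | add_one δ =>
        have h1 : γ ≤ δ := by simpa using hγ
        have h2 : δ ≤ α := by simpa using hδ
        refine raw_succ_ext (by simp) fun b A => ?_
        rw [side_restrict_succ_succ h1, side_restrict_succ_succ h2,
          side_restrict_succ_succ (h1.trans h2), Set.image_image]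
        exact Set.image_congr fun x hx => ih (hw' b A x hx) h2 h1
      | limit m hm =>
        have h := lt_of_le_of_ne hγ (hm.succ_ne γ)
        rw [restrict_succ_limit hm h, component_restrict]

theorem IsPrebiworld.isPrebiworld_restrict {α δ : Ordinal.{0}} {w : Raw S Ag α} (hw : IsPrebiworld w)
    (hδ : δ ≤ α) : IsPrebiworld (restrict hδ w) := by
  induction α using Ordinal.limitRecOn generalizing δ with
  | zero =>
    obtain rfl : δ = 0 := le_antisymm hδ (zero_le)
    exact isPrebiworld_zero _
  | limit l hl ih =>
    rcases hδ.eq_or_lt with rfl | h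
    · rwa [hw.restrict_self]
    · rw [hw.restrict_eq_component hl h]
      exact ((isPrebiworld_limit hl w).1 hw).1 δ h
  | add_one α ih =>
    have hw' := (isPrebiworld_succ_side w).1 hw
    induction δ using Ordinal.limitRecOn with
    | zero => exact isPrebiworld_zero _
    | add_one δ _ =>
      have h : δ ≤ α := by simpa using hδ
      rw [isPrebiworld_succ_side]
      intro b A x hx
      rw [side_restrict_succ_succ h] at hx
      obtain ⟨y, hy, rfl⟩ := hx
      exact ih (hw' b A y hy) h
    | limit m hm ihm =>
      rw [isPrebiworld_limit hm]
      refine ⟨fun γ hγ => ?_, fun γ η hγ hη => ⟨hη, ?_⟩⟩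
      · rw [component_restrict]; exact ihm γ hγ _
      · rw [component_restrict, component_restrict]
        exact hw.restrict_restrict _ _

-- Biworlds in terms of their sides.

theorem IsBiworld.isPrebiworld {α : Ordinal.{0}} {w : Raw S Ag α} (hw : IsBiworld w) :
    IsPrebiworld w := by
  cases α using Ordinal.limitRecOn with
  | zero => exact isPrebiworld_zero w
  | add_one α => exact ((isBiworld_succ w).1 hw).1
  | limit l hl => exact ((isBiworld_limit hl w).1 hw).1

/-- The prebiworld clause disappears because all members are biworlds of the previous depth, hence
prebiworlds. Indexing sides by `Bool` lets later arguments treat both signs at once. -/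
theorem isBiworld_succ_side {α : Ordinal.{0}} (w : Raw S Ag (α + 1)) :
    IsBiworld w ↔ (∀ A x, (∃ b, x ∈ side b w A) ↔ IsBiworld x) ∧
      ∀ A, ∀ x, (∀ b, x ∈ side b w A) → Incompleted x := by
  rw [isBiworld_succ, isPrebiworld_succ_side]
  simp only [side, Set.ext_iff, Bool.exists_bool, Bool.forall_bool, cond_true, cond_false,
    Set.mem_union, Set.mem_inter_iff, Set.mem_ofPred_eq]
  constructor
  · rintro ⟨-, h1, h2⟩
    exact ⟨fun A x => or_comm.trans (h1 A x), fun A x h => h2 A x h.symm⟩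
  · rintro ⟨h1, h2⟩
    exact ⟨⟨fun A x hx => ((h1 A x).1 (.inl hx)).isPrebiworld,
      fun A x hx => ((h1 A x).1 (.inr hx)).isPrebiworld⟩,
      fun A x => or_comm.trans (h1 A x), fun A x h => h2 A x h.symm⟩

/-- No agent has a prebiworld of the previous depth on both sides. -/
def Disj {α : Ordinal.{0}} (w : Raw S Ag (α + 1)) : Prop :=
  ∀ A x, ∃ b, x ∉ side b w A

theorem disj_iff {α : Ordinal.{0}} (w : Raw S Ag (α + 1)) :
    Disj w ↔ ∀ A, poss w A ∩ imposs w A = ∅ := by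
  simp only [Disj, side, Set.eq_empty_iff_forall_notMem, Bool.exists_bool, cond_true, cond_false,
    Set.mem_inter_iff]
  exact forall_congr' fun A => forall_congr' fun x => by tauto

theorem IsBiworld.isBiworld_of_mem {α : Ordinal.{0}} {w : Raw S Ag (α + 1)} (hw : IsBiworld w)
    {b : Bool} {A : Ag} {x : Raw S Ag α} (hx : x ∈ side b w A) : IsBiworld x :=
  (((isBiworld_succ_side w).1 hw).1 A x).1 ⟨b, hx⟩

theorem IsBiworld.exists_mem {α : Ordinal.{0}} {w : Raw S Ag (α + 1)} (hw : IsBiworld w)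
    (A : Ag) {x : Raw S Ag α} (hx : IsBiworld x) : ∃ b, x ∈ side b w A :=
  (((isBiworld_succ_side w).1 hw).1 A x).2 hx

theorem IsBiworld.incompleted_of_mem {α : Ordinal.{0}} {w : Raw S Ag (α + 1)} (hw : IsBiworld w)
    {A : Ag} {x : Raw S Ag α} (hx : ∀ b, x ∈ side b w A) : Incompleted x :=
  ((isBiworld_succ_side w).1 hw).2 A x hx

theorem IsBiworld.mem_not_of_notMem {α : Ordinal.{0}} {w : Raw S Ag (α + 1)} (hw : IsBiworld w)
    {A : Ag} {x : Raw S Ag α} (hx : IsBiworld x) {b : Bool} (hb : x ∉ side b w A) :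
    x ∈ side (!b) w A := by
  obtain ⟨c, hc⟩ := hw.exists_mem A hx
  cases b <;> cases c <;> first | exact hc | exact absurd hc hb

theorem Completed.exists_notMem {α : Ordinal.{0}} {w : Raw S Ag (α + 1)} (hw : IsBiworld w)
    {x : Raw S Ag α} (hx : Completed x) (A : Ag) : ∃ b, x ∉ side b w A := by
  by_contra! h
  exact hx (hw.incompleted_of_mem h)

-- Building and comparing objects at limit depth.

/-- A coherent sequence of biworlds below a limit has a biworld as its limit. -/
theorem exists_biworld_of_coherent {l : Ordinal.{0}} (hl : IsSuccLimit l)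
    (f : ∀ β : Ordinal.{0}, β < l → Raw S Ag β) (hf : ∀ β hβ, IsBiworld (f β hβ))
    (hc : ∀ β γ (hβ : β < l) (hγ : γ ≤ β), restrict hγ (f β hβ) = f γ (hγ.trans_lt hβ)) :
    ∃ w : Raw S Ag l, IsBiworld w ∧ ∀ β (hβ : β < l), restrict hβ.le w = f β hβ := by
  have h : IsBiworld ((limitEquiv hl).symm f) := by
    rw [isBiworld_limit hl, isPrebiworld_limit hl]
    simp only [component_limitEquiv_symm]
    exact ⟨⟨fun β hβ => (hf β hβ).isPrebiworld, fun β γ hβ hγ => ⟨hγ, hc β γ hβ hγ⟩⟩, hf⟩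
  refine ⟨_, h, fun β hβ => ?_⟩
  rw [h.isPrebiworld.restrict_eq_component hl hβ, component_limitEquiv_symm]

/-- Prebiworlds of limit depth are determined by their restrictions. -/
theorem IsPrebiworld.ext_limit {l : Ordinal.{0}} (hl : IsSuccLimit l) {v w : Raw S Ag l}
    (hv : IsPrebiworld v) (hw : IsPrebiworld w)
    (h : ∀ β (hβ : β < l), restrict hβ.le v = restrict hβ.le w) : v = w := by
  refine raw_limit_ext hl fun β hβ => ?_
  rw [← hv.restrict_eq_component hl hβ hβ.le, ← hw.restrict_eq_component hl hβ hβ.le, h _ hβ]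

/-- Criterion for a prebiworld of depth `l + 1` to extend one of limit depth `l`. -/
theorem restrict_eq_of_limit {l : Ordinal.{0}} (hl : IsSuccLimit l) {w : Raw S Ag l}
    (hw : IsPrebiworld w) (v : Raw S Ag (l + 1)) (ho : obj v = obj w)
    (hs : ∀ γ (hγ : γ + 1 < l) b A,
      restrict (lt_of_le_of_lt le_self_add hγ).le '' side b v A =
        side b (restrict hγ.le w) A)
    (h : l ≤ l + 1) : restrict h v = w := by
  have key : ∀ (γ : Ordinal.{0}) (hγ : γ < l), restrict (hγ.le.trans h) v = restrict hγ.le w := by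
    intro γ
    induction γ using Ordinal.limitRecOn with
    | zero => intro hγ; rw [restrict_zero, restrict_zero, ho]
    | add_one γ _ =>
      intro hγ
      refine raw_succ_ext ?_ fun b A => ?_
      · rw [obj_restrict_succ, ho]
        have := congrArg obj (hw.restrict_restrict hγ.le zero_le)
        rw [restrict_zero, restrict_zero, obj_zero, obj_zero] at this
        simpa using this.symm
      · rw [side_restrict_succ_succ (lt_of_le_of_lt le_self_add hγ).le, hs γ hγ]
    | limit m hm ihm =>
      intro hγ
      refine raw_limit_ext hm fun δ hδ => ?_
      rw [component_restrict, component_restrict, ihm δ hδ (hδ.trans hγ)]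
  refine raw_limit_ext hl fun γ hγ => ?_
  rw [component_restrict, key γ hγ, hw.restrict_eq_component hl hγ]

-- Completedness and uniqueness of extensions.

/-- A biworld that leaves no agent undecided at some smaller depth is completed. -/
theorem completed_of_disj_restrict {α γ : Ordinal.{0}} (h : α + 1 ≤ γ) {w : Raw S Ag γ}
    (hd : Disj (restrict h w)) : Completed w := by
  rw [Completed, incompleted_iff]
  rintro ⟨v₁, v₂, h₁, h₂, hne, ⟨h', e₁⟩, ⟨_, e₂⟩⟩
  have le : α ≤ γ := le_self_add.trans h
  have mem : ∀ {v : Raw S Ag (γ + 1)}, IsBiworld v → restrict h' v = w →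
      ∀ b A, ∀ x ∈ side b v A, restrict le x ∈ side b (restrict h w) A := by
    intro v hv e b A x hx
    rw [← e, hv.isPrebiworld.restrict_restrict, side_restrict_succ_succ le]
    exact ⟨x, hx, rfl⟩
  -- An element on side `b` of `v₁` but not of `v₂` is on the opposite side of `v₂`, so its
  -- restriction would lie on both of the disjoint sides.
  have key : ∀ {v₁ v₂ : Raw S Ag (γ + 1)}, IsBiworld v₁ → IsBiworld v₂ →
      restrict h' v₁ = w → restrict h' v₂ = w → ∀ b A, side b v₁ A ⊆ side b v₂ A := by
    intro v₁ v₂ h₁ h₂ e₁ e₂ b A x hx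
    by_contra hn
    have m₁ := mem h₁ e₁ b A x hx
    have m₂ := mem h₂ e₂ _ A x (h₂.mem_not_of_notMem (h₁.isBiworld_of_mem hx) hn)
    obtain ⟨c, hc⟩ := hd A (restrict le x)
    cases b <;> cases c <;> first | exact hc m₁ | exact hc m₂
  refine hne (raw_succ_ext ?_ fun b A => (key h₁ h₂ e₁ e₂ b A).antisymm (key h₂ h₁ e₂ e₁ b A))
  rw [← obj_restrict_succ h' v₁, ← obj_restrict_succ h' v₂, e₁, e₂]

theorem Disj.completed {α : Ordinal.{0}} {w : Raw S Ag (α + 1)} (hw : IsBiworld w)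
    (hd : Disj w) : Completed w := by
  refine completed_of_disj_restrict le_rfl ?_
  rwa [hw.isPrebiworld.restrict_self]

theorem Completed.eq_of_restrict {α : Ordinal.{0}} {w : Raw S Ag α} (hw : Completed w)
    {v₁ v₂ : Raw S Ag (α + 1)} (h₁ : IsBiworld v₁) (h₂ : IsBiworld v₂) (h : α ≤ α + 1)
    (e₁ : restrict h v₁ = w) (e₂ : restrict h v₂ = w) : v₁ = v₂ := by
  by_contra hne
  exact hw ((incompleted_iff w).2 ⟨v₁, v₂, h₁, h₂, hne, ⟨h, e₁⟩, ⟨h, e₂⟩⟩)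

variable (S Ag) in
/-- Biworlds of depth `β` have biworlds as restrictions, all biworlds of smaller depth extend to
depth `β`, and those of depth `β` have extensions to depth `β + 1` with disjoint sides. -/
structure Regular (β : Ordinal.{0}) : Prop where
  restr : ∀ {α : Ordinal.{0}} (h : α ≤ β) (w : Raw S Ag β), IsBiworld w → IsBiworld (restrict h w)
  ext : ∀ {α : Ordinal.{0}} (h : α ≤ β) (y : Raw S Ag α), IsBiworld y →
    ∃ w : Raw S Ag β, IsBiworld w ∧ restrict h w = y
  next : ∀ w : Raw S Ag β, IsBiworld w →
    ∃ v : Raw S Ag (β + 1), IsBiworld v ∧ restrict le_self_add v = w ∧ Disj v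

/-- A biworld that extends a completed one is completed. -/
theorem Regular.completed {α β : Ordinal.{0}} (hα : Regular S Ag α) (hβ : Regular S Ag β)
    (h : α ≤ β) {w : Raw S Ag β} (hw : IsBiworld w) (hc : Completed (restrict h w)) :
    Completed w := by
  rcases h.eq_or_lt with rfl | hlt
  · rwa [hw.isPrebiworld.restrict_self] at hc
  · have hle : α + 1 ≤ β := add_one_le_of_lt hlt
    -- Completedness leaves only one extension of depth `α + 1`, so `w` passes through the one with
    -- disjoint sides.
    obtain ⟨v, hv, hvr, hd⟩ := hα.next _ (hβ.restr h w hw)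
    refine completed_of_disj_restrict hle ?_
    rwa [hc.eq_of_restrict (hβ.restr hle w hw) hv le_self_add
      (hw.isPrebiworld.restrict_restrict _ _) hvr]

/-- A completed biworld has at most one extension of each depth. -/
theorem eq_of_restrict_completed {α β : Ordinal.{0}} (h : α ≤ β)
    (H : ∀ γ ≤ β, Regular S Ag γ) {w₁ w₂ : Raw S Ag β} (h₁ : IsBiworld w₁) (h₂ : IsBiworld w₂)
    (he : restrict h w₁ = restrict h w₂) (hc : Completed (restrict h w₁)) : w₁ = w₂ := by
  induction β using Ordinal.limitRecOn with
  | zero =>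
    obtain rfl : α = 0 := le_antisymm h zero_le
    rwa [h₁.isPrebiworld.restrict_self, h₂.isPrebiworld.restrict_self] at he
  | add_one β ih =>
    rcases h.eq_or_lt with rfl | hlt
    · rwa [h₁.isPrebiworld.restrict_self, h₂.isPrebiworld.restrict_self] at he
    · have hle : α ≤ β := lt_add_one_iff.1 hlt
      have hβ : β ≤ β + 1 := le_self_add
      rw [← h₁.isPrebiworld.restrict_restrict hβ hle] at he hc
      rw [← h₂.isPrebiworld.restrict_restrict hβ hle] at he
      have b₁ := (H _ le_rfl).restr hβ w₁ h₁
      have b₂ := (H _ le_rfl).restr hβ w₂ h₂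
      have := ih hle (fun γ hγ => H γ (hγ.trans hβ)) b₁ b₂ he hc
      exact ((H α h).completed (H β hβ) hle b₁ hc).eq_of_restrict h₁ h₂ hβ rfl this.symm
  | limit l hl ih =>
    rcases h.eq_or_lt with rfl | hlt
    · rwa [h₁.isPrebiworld.restrict_self, h₂.isPrebiworld.restrict_self] at he
    · have key : ∀ γ (hγ : γ < l), α ≤ γ → restrict hγ.le w₁ = restrict hγ.le w₂ := by
        intro γ hγ hle
        rw [← h₁.isPrebiworld.restrict_restrict hγ.le hle] at he hc
        rw [← h₂.isPrebiworld.restrict_restrict hγ.le hle] at he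
        exact ih γ hγ hle (fun δ hδ => H δ (hδ.trans hγ.le)) ((H _ le_rfl).restr _ _ h₁)
          ((H _ le_rfl).restr _ _ h₂) he hc
      refine h₁.isPrebiworld.ext_limit hl h₂.isPrebiworld fun γ hγ => ?_
      -- Agreement is known only from depth `α` on; smaller depths follow by restricting from the
      -- maximum.
      have hm : max γ α < l := max_lt hγ hlt
      rw [← h₁.isPrebiworld.restrict_restrict hm.le (le_max_left γ α),
        ← h₂.isPrebiworld.restrict_restrict hm.le (le_max_left γ α), key _ hm (le_max_right _ _)]

-- Splitting overlaps at successor depth.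

/-- The extension of `w` by one level that resolves each element `y` on both sides of an agent by
putting the extension `e y` on the negative side and all others on the positive side. -/
noncomputable def split {ν : Ordinal.{0}} (w : Raw S Ag (ν + 1))
    (e : Raw S Ag ν → Raw S Ag (ν + 1)) : Raw S Ag (ν + 1 + 1) :=
  mkSucc (obj w) fun b A => {x | IsBiworld x ∧ restrict le_self_add x ∈ side b w A ∧
    (restrict le_self_add x ∈ side (!b) w A → (x = e (restrict le_self_add x) ↔ b = false))}

theorem mem_side_split {ν : Ordinal.{0}} {w : Raw S Ag (ν + 1)}
    {e : Raw S Ag ν → Raw S Ag (ν + 1)} {b : Bool} {A : Ag} {x : Raw S Ag (ν + 1)} :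
    x ∈ side b (split w e) A ↔ IsBiworld x ∧ restrict le_self_add x ∈ side b w A ∧
      (restrict le_self_add x ∈ side (!b) w A →
        (x = e (restrict le_self_add x) ↔ b = false)) := by
  simp [split]

theorem disj_split {ν : Ordinal.{0}} (w : Raw S Ag (ν + 1))
    (e : Raw S Ag ν → Raw S Ag (ν + 1)) : Disj (split w e) := by
  intro A x
  by_contra! h
  have h1 := mem_side_split.1 (h true)
  have h2 := mem_side_split.1 (h false)
  have h3 := h1.2.2 h2.2.1
  have h4 := h2.2.2 h1.2.1
  simp_all

/-- The hypothesis on restrictions is explicit because this is needed while regularity at `ν + 1` is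
still being established. -/
theorem isBiworld_split {ν : Ordinal.{0}} {w : Raw S Ag (ν + 1)} (hw : IsBiworld w)
    {e : Raw S Ag ν → Raw S Ag (ν + 1)}
    (hres : ∀ x : Raw S Ag (ν + 1), IsBiworld x →
      IsBiworld (restrict (le_self_add : ν ≤ ν + 1) x)) :
    IsBiworld (split w e) := by
  rw [isBiworld_succ_side]
  refine ⟨fun A x => ⟨fun ⟨b, hb⟩ => (mem_side_split.1 hb).1, fun hx => ?_⟩, fun A x hx => ?_⟩
  · simp only [mem_side_split]
    obtain ⟨b, hb⟩ := hw.exists_mem A (hres x hx)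
    by_cases hb' : restrict le_self_add x ∈ side (!b) w A
    · by_cases hxe : x = e (restrict le_self_add x)
      · exact ⟨false, hx, by cases b <;> assumption, fun _ => by simp [← hxe]⟩
      · exact ⟨true, hx, by cases b <;> assumption, fun _ => by simp [hxe]⟩
    · exact ⟨b, hx, hb, fun h => absurd h hb'⟩
  · obtain ⟨b, hb⟩ := disj_split w e A x
    exact absurd (hx b) hb

/-- Above an overlapping `y`, the extension `e y` covers `y` negatively and a second extension
covers it positively; above any other `y`, every extension inherits the side of `y`. -/
theorem restrict_split {ν : Ordinal.{0}} {w : Raw S Ag (ν + 1)} (hw : IsBiworld w)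
    {e : Raw S Ag ν → Raw S Ag (ν + 1)}
    (hext : ∀ y : Raw S Ag ν, IsBiworld y →
      ∃ x : Raw S Ag (ν + 1), IsBiworld x ∧ restrict le_self_add x = y)
    (he : ∀ y, Incompleted y → IsBiworld (e y) ∧ restrict le_self_add (e y) = y ∧
      ∃ z, IsBiworld z ∧ restrict le_self_add z = y ∧ z ≠ e y) (h : ν + 1 ≤ ν + 1 + 1) :
    restrict h (split w e) = w := by
  refine raw_succ_ext (by simp [split]) fun b A => ?_
  rw [side_restrict_succ_succ le_self_add]
  ext y
  constructor
  · rintro ⟨x, hx, rfl⟩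
    exact (mem_side_split.1 hx).2.1
  · intro hy
    by_cases hy' : y ∈ side (!b) w A
    · have hinc : Incompleted y := hw.incompleted_of_mem (A := A) fun c => by
        cases b <;> cases c <;> assumption
      obtain ⟨h1, h2, z, h3, h4, h5⟩ := he y hinc
      cases b
      · exact ⟨e y, mem_side_split.2 ⟨h1, by rwa [h2], fun _ => by simp [h2]⟩, h2⟩
      · exact ⟨z, mem_side_split.2 ⟨h3, by rwa [h4], fun _ => by simp [h4, h5]⟩, h4⟩
    · obtain ⟨x, hx, rfl⟩ := hext y (hw.isBiworld_of_mem hy)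
      exact ⟨x, mem_side_split.2 ⟨hx, hy, fun h => absurd h hy'⟩, rfl⟩

theorem exists_resolving (ν : Ordinal.{0}) : ∃ e : Raw S Ag ν → Raw S Ag (ν + 1),
    ∀ y, Incompleted y → IsBiworld (e y) ∧ restrict le_self_add (e y) = y ∧
      ∃ z, IsBiworld z ∧ restrict le_self_add z = y ∧ z ≠ e y := by
  have : ∀ y : Raw S Ag ν, ∃ x : Raw S Ag (ν + 1), Incompleted y →
      IsBiworld x ∧ restrict le_self_add x = y ∧
        ∃ z, IsBiworld z ∧ restrict le_self_add z = y ∧ z ≠ x := by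
    intro y
    by_cases hy : Incompleted y
    · obtain ⟨v₁, v₂, h₁, h₂, hne, ⟨_, e₁⟩, ⟨_, e₂⟩⟩ := (incompleted_iff y).1 hy
      exact ⟨v₁, fun _ => ⟨h₁, e₁, v₂, h₂, e₂, hne.symm⟩⟩
    -- A junk value: a completed `y` never lies on both sides of a biworld.
    · exact ⟨mkSucc (obj y) fun _ _ => ∅, fun h => absurd h hy⟩
  exact Classical.skolem.1 this

/-- A completed biworld of successor depth has disjoint sides. -/
theorem Completed.disj {ν : Ordinal.{0}} (H : Regular S Ag ν) {w : Raw S Ag (ν + 1)}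
    (hres : ∀ x : Raw S Ag (ν + 1), IsBiworld x →
      IsBiworld (restrict (le_self_add : ν ≤ ν + 1) x))
    (hw : IsBiworld w) (hc : Completed w) : Disj w := by
  classical
  by_contra hd
  simp only [Disj, not_forall, not_exists, not_not] at hd
  obtain ⟨A, y, hy⟩ := hd
  obtain ⟨v₁, v₂, h₁, h₂, hne, ⟨_, e₁⟩, ⟨_, e₂⟩⟩ :=
    (incompleted_iff y).1 (hw.incompleted_of_mem hy)
  obtain ⟨e, he⟩ := exists_resolving (S := S) (Ag := Ag) ν
  have hext : ∀ y : Raw S Ag ν, IsBiworld y →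
      ∃ x : Raw S Ag (ν + 1), IsBiworld x ∧ restrict le_self_add x = y := fun y hy =>
    let ⟨x, hx, hr, _⟩ := H.next y hy
    ⟨x, hx, hr⟩
  -- Changing the resolving choice at `y` alone keeps it admissible, as long as another extension of
  -- `y` remains for the positive side.
  have hupd : ∀ a b : Raw S Ag (ν + 1), IsBiworld a → IsBiworld b →
      restrict le_self_add a = y → restrict le_self_add b = y → a ≠ b →
      ∀ z, Incompleted z → IsBiworld (Function.update e y a z) ∧
        restrict le_self_add (Function.update e y a z) = z ∧
          ∃ t, IsBiworld t ∧ restrict le_self_add t = z ∧ t ≠ Function.update e y a z := by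
    intro a b ha hb ra rb hab z hz
    by_cases hzy : z = y
    · subst hzy
      simpa using ⟨ha, ra, b, hb, rb, hab.symm⟩
    · simpa [hzy] using he z hz
  have heq := hc.eq_of_restrict (isBiworld_split hw hres) (isBiworld_split hw hres) le_self_add
    (restrict_split hw hext (hupd v₁ v₂ h₁ h₂ e₁ e₂ hne) _)
    (restrict_split hw hext (hupd v₂ v₁ h₂ h₁ e₂ e₁ hne.symm) _)
  -- The two splits coincide by completedness, yet `v₁` is negative in the first and positive in the
  -- second.
  have m₁ : v₁ ∈ side false (split w (Function.update e y v₁)) A :=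
    mem_side_split.2 ⟨h₁, by rw [e₁]; exact hy _, fun _ => by simp [e₁]⟩
  have m₂ : v₁ ∈ side true (split w (Function.update e y v₂)) A :=
    mem_side_split.2 ⟨h₁, by rw [e₁]; exact hy _, fun _ => by simp [e₁, hne]⟩
  rw [← heq] at m₂
  obtain ⟨b, hb⟩ := disj_split w (Function.update e y v₁) A v₁
  cases b <;> contradiction

-- Regularity at zero and at successors.

theorem restr_zero {α : Ordinal.{0}} (h : α ≤ 0) (w : Raw S Ag 0) : IsBiworld (restrict h w) := by
  obtain rfl : α = 0 := le_antisymm h zero_le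
  exact isBiworld_zero _

theorem regular_zero : Regular S Ag 0 where
  restr h w _ := restr_zero h w
  ext h y hy := by
    obtain rfl := le_antisymm h zero_le
    exact ⟨y, hy, hy.isPrebiworld.restrict_self _⟩
  next w hw := by
    -- Any partition of the interpretations would serve; here all of them are positive.
    refine ⟨mkSucc (obj w) fun b _ => {_x | b = true}, ?_, ?_, ?_⟩
    · rw [isBiworld_succ_side]
      refine ⟨fun A x => ⟨fun _ => isBiworld_zero x, fun _ => ⟨true, by simp⟩⟩, fun A x hx => ?_⟩
      simpa using hx false
    · simp [restrict_zero, obj_zero]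
    · exact fun A x => ⟨false, by simp⟩

/-- Extendability makes the restricted sides cover all biworlds of depth `α`. A completed element on
both restricted sides would have a unique extension to depth `β`, which would overlap in `w` and so
be incompleted, against inheritance of completedness. -/
theorem isBiworld_restrict_succ {β : Ordinal.{0}} (H : ∀ γ ≤ β, Regular S Ag γ) {α : Ordinal.{0}}
    (h : α ≤ β + 1) {w : Raw S Ag (β + 1)} (hw : IsBiworld w) : IsBiworld (restrict h w) := by
  induction α using Ordinal.limitRecOn with
  | zero => exact isBiworld_zero _
  | limit m hm ih =>
    rw [isBiworld_limit hm]
    refine ⟨hw.isPrebiworld.isPrebiworld_restrict h, fun γ hγ => ?_⟩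
    rw [component_restrict]
    exact ih γ hγ _
  | add_one α _ =>
    have hle : α ≤ β := by simpa using h
    rw [isBiworld_succ_side]
    simp only [side_restrict_succ_succ hle]
    refine ⟨fun A x => ⟨?_, fun hx => ?_⟩, fun A x hx => ?_⟩
    · rintro ⟨b, y, hy, rfl⟩
      exact (H β le_rfl).restr hle y (hw.isBiworld_of_mem hy)
    · obtain ⟨y, hy, rfl⟩ := (H β le_rfl).ext hle x hx
      obtain ⟨b, hb⟩ := hw.exists_mem A hy
      exact ⟨b, y, hb, rfl⟩
    · obtain ⟨y, hy, rfl⟩ := hx true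
      obtain ⟨z, hz, hzy⟩ := hx false
      by_contra hc
      have hyb := hw.isBiworld_of_mem hy
      obtain rfl := eq_of_restrict_completed hle H hyb (hw.isBiworld_of_mem hz) hzy.symm hc
      refine (H α hle).completed (H β le_rfl) hle hyb hc (hw.incompleted_of_mem (A := A) fun b => ?_)
      cases b <;> assumption

theorem regular_succ {β : Ordinal.{0}} (H : ∀ γ ≤ β, Regular S Ag γ) : Regular S Ag (β + 1) where
  restr h _ hw := isBiworld_restrict_succ H h hw
  ext {α} h y hy := by
    rcases h.eq_or_lt with rfl | hlt
    · exact ⟨y, hy, hy.isPrebiworld.restrict_self _⟩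
    · have hle : α ≤ β := lt_add_one_iff.1 hlt
      obtain ⟨x, hx, rfl⟩ := (H β le_rfl).ext hle y hy
      obtain ⟨v, hv, rfl, -⟩ := (H β le_rfl).next x hx
      exact ⟨v, hv, (hv.isPrebiworld.restrict_restrict _ _).symm⟩
  next w hw := by
    obtain ⟨e, he⟩ := exists_resolving (S := S) (Ag := Ag) β
    refine ⟨split w e, isBiworld_split hw fun x hx => isBiworld_restrict_succ H _ hx,
      restrict_split hw (fun y hy => ?_) he _, disj_split w e⟩
    obtain ⟨v, hv, hvr, -⟩ := (H β le_rfl).next y hy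
    exact ⟨v, hv, hvr⟩

-- Restriction and extension at limit depth.

theorem IsBiworld.isBiworld_restrict_limit {l : Ordinal.{0}} (hl : IsSuccLimit l)
    {w : Raw S Ag l} (hw : IsBiworld w) {α : Ordinal.{0}} (h : α ≤ l) :
    IsBiworld (restrict h w) := by
  rcases h.eq_or_lt with rfl | hlt
  · rwa [hw.isPrebiworld.restrict_self]
  · rw [hw.isPrebiworld.restrict_eq_component hl hlt]
    exact ((isBiworld_limit hl w).1 hw).2 α hlt

theorem exists_extension_limit {l : Ordinal.{0}} (hl : IsSuccLimit l)
    (H : ∀ γ < l, Regular S Ag γ) {α : Ordinal.{0}} (h : α ≤ l) {y : Raw S Ag α}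
    (hy : IsBiworld y) : ∃ w : Raw S Ag l, IsBiworld w ∧ restrict h w = y := by
  rcases h.eq_or_lt with rfl | hlt
  · exact ⟨y, hy, hy.isPrebiworld.restrict_self _⟩
  -- Replacing `y` by a completed `y'` makes extensions unique at each depth, so independently
  -- chosen ones cohere automatically and countability is not needed.
  obtain ⟨y', hy', rfl, hd⟩ := (H α hlt).next y hy
  have hlt' : α + 1 < l := hl.succ_lt hlt
  choose t ht htr using fun η (hη : η < l) (h : α + 1 ≤ η) => (H η hη).ext h y' hy'
  have huniq : ∀ η δ (hη : η < l) (hδ : α + 1 ≤ δ) (hle : δ ≤ η),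
      restrict hle (t η hη (hδ.trans hle)) = t δ (hle.trans_lt hη) hδ := by
    intro η δ hη hδ hle
    refine eq_of_restrict_completed hδ (fun γ hγ => H γ (hγ.trans_lt (hle.trans_lt hη)))
      ((H η hη).restr _ _ (ht _ _ _)) (ht _ _ _) ?_ ?_ <;>
      rw [(ht _ _ _).isPrebiworld.restrict_restrict, htr]
    · rw [htr]
    · exact hd.completed hy'
  have hm : ∀ β < l, max β (α + 1) < l := fun β hβ => max_lt hβ hlt'
  obtain ⟨w, hw, hwr⟩ := exists_biworld_of_coherent hl
    (fun β hβ => restrict (le_max_left β (α + 1)) (t _ (hm β hβ) (le_max_right _ _)))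
    (fun β hβ => (H _ (hm β hβ)).restr _ _ (ht _ _ _)) fun β γ hβ hγ => by
      rw [(ht _ _ _).isPrebiworld.restrict_restrict,
        ← huniq _ _ (hm β hβ) (le_max_right γ _) (max_le_max_right _ hγ),
        (ht _ _ _).isPrebiworld.restrict_restrict]
  refine ⟨w, hw, ?_⟩
  rw [hwr α hlt, ← htr _ (hm α hlt) (le_max_right _ _),
    (ht _ _ _).isPrebiworld.restrict_restrict]

-- Allotting branches to sides at limit depth.

section Limit

variable {l : Ordinal.{0}} {w : Raw S Ag l}

/-- The side of the restriction of `w` to depth `γ + 1`. -/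
noncomputable def sideAt (w : Raw S Ag l) (b : Bool) (A : Ag) {γ : Ordinal.{0}} (hγ : γ < l) :
    Set (Raw S Ag γ) :=
  side b (restrict (add_one_le_of_lt hγ) w) A

theorem sideAt_eq_image (hw : IsPrebiworld w) (b : Bool) (A : Ag) {γ δ : Ordinal.{0}}
    (hγδ : γ ≤ δ) (hδ : δ < l) :
    sideAt w b A (hγδ.trans_lt hδ) = restrict hγδ '' sideAt w b A hδ := by
  rw [sideAt, sideAt, ← side_restrict_succ_succ hγδ (by simpa using hγδ), hw.restrict_restrict]

/-- The biworlds of limit depth `l` whose restrictions all lie in the given side of `w`. -/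
def branches (w : Raw S Ag l) (b : Bool) (A : Ag) : Set (Raw S Ag l) :=
  {x | IsBiworld x ∧ ∀ δ (hδ : δ < l), restrict hδ.le x ∈ sideAt w b A hδ}

/-- Sides are preserved downwards. Were both sides left at some depth, the side containing `x` at
the larger of the two depths would give a contradiction. -/
theorem exists_mem_branches (hl : IsSuccLimit l) (hw : IsBiworld w) (A : Ag) {x : Raw S Ag l}
    (hx : IsBiworld x) : ∃ b, x ∈ branches w b A := by
  by_contra! h
  have h' : ∀ b, ∃ δ, ∃ hδ : δ < l, restrict hδ.le x ∉ sideAt w b A hδ := by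
    intro b
    by_contra! hb
    exact h b ⟨hx, hb⟩
  choose d hd hdn using h'
  have hm : max (d true) (d false) < l := max_lt (hd _) (hd _)
  obtain ⟨c, hc⟩ := (hw.isBiworld_restrict_limit hl (add_one_le_of_lt hm)).exists_mem A
    (hx.isBiworld_restrict_limit hl hm.le)
  have hle : d c ≤ max (d true) (d false) := by cases c <;> simp
  apply hdn c
  rw [sideAt_eq_image hw.isPrebiworld c A hle hm]
  exact ⟨_, hc, hx.isPrebiworld.restrict_restrict _ _⟩

/-- At limits of countable cofinality, each element of a side extends to a branch. -/
theorem exists_branch (hl : IsSuccLimit l) (hcard : l.card ≤ Cardinal.aleph0) (hw : IsBiworld w)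
    {b : Bool} {A : Ag} {γ : Ordinal.{0}} (hγ : γ < l) {y : Raw S Ag γ}
    (hy : y ∈ sideAt w b A hγ) : ∃ x ∈ branches w b A, restrict hγ.le x = y := by
  have : Countable (Set.Iio l) := by
    rw [← Cardinal.mk_le_aleph0_iff, Cardinal.mk_Iio_ordinal]
    simpa only [← Ordinal.lift_card, Cardinal.lift_le_aleph0] using hcard
  have : Nonempty (Set.Iio l) := ⟨⟨γ, hγ⟩⟩
  obtain ⟨f, hf, hft⟩ := Filter.exists_seq_monotone_tendsto_atTop_atTop (Set.Iio l)
  -- The cofinal sequence is raised to start at or above `γ`, so the climb can begin from an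
  -- extension of `y`.
  set g : ℕ → Ordinal.{0} := fun n => max γ (f n)
  have hgl : ∀ n, g n < l := fun n => max_lt hγ (f n).2
  have hg : Monotone g := fun m n h => max_le_max_left _ (hf h)
  have hcof : ∀ δ < l, ∃ n, δ ≤ g n := by
    intro δ hδ
    obtain ⟨n, hn⟩ := (hft.eventually_ge_atTop (⟨δ, hδ⟩ : Set.Iio l)).exists
    exact ⟨n, le_max_of_le_right hn⟩
  have hbi : ∀ {δ : Ordinal.{0}} (hδ : δ < l) {z : Raw S Ag δ}, z ∈ sideAt w b A hδ →
      IsBiworld z := fun hδ _ hz =>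
    (hw.isBiworld_restrict_limit hl (add_one_le_of_lt hδ)).isBiworld_of_mem hz
  have lift : ∀ {δ η : Ordinal.{0}} (h : δ ≤ η) (hη : η < l) (z : Raw S Ag δ),
      z ∈ sideAt w b A (h.trans_lt hη) → ∃ t ∈ sideAt w b A hη, restrict h t = z := by
    intro δ η h hη z hz
    rwa [sideAt_eq_image hw.isPrebiworld b A h hη] at hz
  obtain ⟨y₀, hy₀, hy₀r⟩ := lift (le_max_left γ (f 0)) (hgl 0) y hy
  choose step hstep hstepr using fun n (z : sideAt w b A (hgl n)) =>
    lift (hg n.le_succ) (hgl (n + 1)) z.1 z.2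
  let Y : ∀ n, sideAt w b A (hgl n) := fun n =>
    Nat.rec (motive := fun n => sideAt w b A (hgl n)) ⟨y₀, hy₀⟩
      (fun n z => ⟨step n z, hstep n z⟩) n
  have hYb : ∀ n, IsBiworld (Y n).1 := fun n => hbi (hgl n) (Y n).2
  have hY : ∀ m n (h : m ≤ n), restrict (hg h) (Y n).1 = (Y m).1 := by
    intro m n h
    induction n, h using Nat.le_induction with
    | base => exact (hYb m).isPrebiworld.restrict_self _
    | succ n h ih =>
      rw [← (hYb (n + 1)).isPrebiworld.restrict_restrict (hg n.le_succ) (hg h), ← ih]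
      exact congrArg _ (hstepr n (Y n))
  choose N hN using hcof
  -- The restriction to `δ` does not depend on the stage from which it is taken.
  have hF : ∀ δ (hδ : δ < l) n (hn : δ ≤ g n),
      restrict (hN δ hδ) (Y (N δ hδ)).1 = restrict hn (Y n).1 := by
    intro δ hδ n hn
    rcases le_total (N δ hδ) n with h | h
    · rw [← hY _ _ h, (hYb n).isPrebiworld.restrict_restrict]
    · rw [← hY _ _ h, (hYb _).isPrebiworld.restrict_restrict]
  have hFs : ∀ δ (hδ : δ < l), restrict (hN δ hδ) (Y (N δ hδ)).1 ∈ sideAt w b A hδ := by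
    intro δ hδ
    rw [sideAt_eq_image hw.isPrebiworld b A (hN δ hδ) (hgl _)]
    exact ⟨_, (Y _).2, rfl⟩
  obtain ⟨x, hx, hxr⟩ := exists_biworld_of_coherent hl
    (fun δ hδ => restrict (hN δ hδ) (Y (N δ hδ)).1) (fun δ hδ => hbi hδ (hFs δ hδ))
    fun β γ hβ hγ => by
      rw [(hYb _).isPrebiworld.restrict_restrict, hF γ (hγ.trans_lt hβ)]
  refine ⟨x, ⟨hx, fun δ hδ => ?_⟩, ?_⟩
  · rw [hxr]; exact hFs δ hδ
  · rw [hxr γ hγ, hF γ hγ 0 (le_max_left _ _)]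
    exact hy₀r

/-- `y` has an extension below `l` that `w` puts on the positive side only. -/
def HasPositiveExt (w : Raw S Ag l) (A : Ag) {γ : Ordinal.{0}} (y : Raw S Ag γ) : Prop :=
  ∃ δ, ∃ (h : γ ≤ δ) (hδ : δ < l) (z : Raw S Ag δ),
    IsBiworld z ∧ restrict h z = y ∧ z ∉ sideAt w false A hδ

/-- The extension of `w` by one level that resolves each branch `x` on both sides: negatively if
every restriction of `x` has an extension on the positive side only, and positively otherwise. -/
noncomputable def limitSplit (w : Raw S Ag l) : Raw S Ag (l + 1) :=
  mkSucc (obj w) fun b A => {x | x ∈ branches w b A ∧ (x ∈ branches w (!b) A →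
    (b = true ↔ ∃ δ, ∃ hδ : δ < l, ¬ HasPositiveExt w A (restrict hδ.le x)))}

theorem mem_side_limitSplit {b : Bool} {A : Ag} {x : Raw S Ag l} :
    x ∈ side b (limitSplit w) A ↔ x ∈ branches w b A ∧ (x ∈ branches w (!b) A →
      (b = true ↔ ∃ δ, ∃ hδ : δ < l, ¬ HasPositiveExt w A (restrict hδ.le x))) := by
  simp only [limitSplit, side_mkSucc, Set.mem_ofPred_eq]

theorem disj_limitSplit (w : Raw S Ag l) : Disj (limitSplit w) := by
  intro A x
  by_contra! h
  have h1 := mem_side_limitSplit.1 (h true)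
  have h2 := mem_side_limitSplit.1 (h false)
  have h3 := h1.2 h2.1
  have h4 := h2.2 h1.1
  exact absurd (h4.2 (h3.1 rfl)) (by simp)

theorem isBiworld_limitSplit (hl : IsSuccLimit l) (hw : IsBiworld w) :
    IsBiworld (limitSplit w) := by
  rw [isBiworld_succ_side]
  refine ⟨fun A x => ⟨fun ⟨b, hb⟩ => (mem_side_limitSplit.1 hb).1.1, fun hx => ?_⟩,
    fun A x hx => ?_⟩
  · simp only [mem_side_limitSplit]
    obtain ⟨b, hb⟩ := exists_mem_branches hl hw A hx
    by_cases hb' : x ∈ branches w (!b) A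
    · by_cases hU : ∃ δ, ∃ hδ : δ < l, ¬ HasPositiveExt w A (restrict hδ.le x)
      · exact ⟨true, by cases b <;> assumption, fun _ => iff_of_true rfl hU⟩
      · exact ⟨false, by cases b <;> assumption, fun _ => iff_of_false (by simp) hU⟩
    · exact ⟨b, hb, fun h => absurd h hb'⟩
  · obtain ⟨b, hb⟩ := disj_limitSplit w A x
    exact absurd (hx b) hb

/-- If some extension of `y` avoids the opposite side, any branch through it lies on side `b` only
and is not subject to the allotment. Otherwise the rule of `limitSplit` sends every overlapping
branch through `y` to side `b`. -/
theorem restrict_limitSplit (hl : IsSuccLimit l) (hcard : l.card ≤ Cardinal.aleph0)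
    (H : ∀ γ < l, Regular S Ag γ) (hw : IsBiworld w) (h : l ≤ l + 1) :
    restrict h (limitSplit w) = w := by
  refine restrict_eq_of_limit hl hw.isPrebiworld _ (by simp [limitSplit]) (fun γ hγ' b A => ?_) h
  have hγ : γ < l := lt_of_le_of_lt le_self_add hγ'
  change restrict hγ.le '' _ = sideAt w b A hγ
  ext y
  constructor
  · rintro ⟨x, hx, rfl⟩
    exact (mem_side_limitSplit.1 hx).1.2 γ hγ
  · intro hy
    by_cases hex : ∃ δ, ∃ (h : γ ≤ δ) (hδ : δ < l) (z : Raw S Ag δ),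
        IsBiworld z ∧ restrict h z = y ∧ z ∉ sideAt w (!b) A hδ
    · obtain ⟨δ, h, hδ, z, hz, rfl, hn⟩ := hex
      obtain ⟨x, hx, rfl⟩ := exists_extension_limit hl H hδ.le hz
      have hxn : x ∉ branches w (!b) A := fun hx' => hn (hx'.2 δ hδ)
      obtain ⟨c, hc⟩ := exists_mem_branches hl hw A hx
      have hxb : x ∈ branches w b A := by
        cases b <;> cases c <;> first | exact hc | exact absurd hc hxn
      exact ⟨x, mem_side_limitSplit.2 ⟨hxb, fun h => absurd h hxn⟩,
        (hx.isPrebiworld.restrict_restrict _ _).symm⟩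
    · obtain ⟨x, hx, hxr⟩ := exists_branch hl hcard hw hγ hy
      refine ⟨x, mem_side_limitSplit.2 ⟨hx, fun _ => ?_⟩, hxr⟩
      cases b with
      | true => exact iff_of_true rfl ⟨γ, hγ, by rw [hxr]; exact hex⟩
      | false =>
        refine iff_of_false (by simp) ?_
        rintro ⟨δ, hδ, hU⟩
        apply hU
        have hm : max γ δ < l := max_lt hγ hδ
        have hm' : max γ δ + 1 < l := hl.succ_lt hm
        -- A disjoint extension `z` is completed, so it misses a side. It cannot miss the positive
        -- side, since it extends `y`; hence it is the required positive-only extension of `x`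
        -- restricted to `δ`.
        obtain ⟨z, hz, hzr, hd⟩ :=
          (H _ hm).next _ (hx.1.isBiworld_restrict_limit hl hm.le)
        have hγz : γ ≤ max γ δ + 1 := (le_max_left _ _).trans le_self_add
        have hδz : δ ≤ max γ δ + 1 := (le_max_right _ _).trans le_self_add
        refine ⟨_, hδz, hm', z, hz, ?_, ?_⟩
        · rw [← hz.isPrebiworld.restrict_restrict le_self_add (le_max_right γ δ), hzr,
            hx.1.isPrebiworld.restrict_restrict]
        · obtain ⟨c, hc⟩ := (hd.completed hz).exists_notMem
            (hw.isBiworld_restrict_limit hl (add_one_le_of_lt hm')) A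
          cases c with
          | false => exact hc
          | true =>
            refine absurd ⟨_, hγz, hm', z, hz, ?_, hc⟩ hex
            rw [← hz.isPrebiworld.restrict_restrict le_self_add (le_max_left γ δ), hzr,
              hx.1.isPrebiworld.restrict_restrict, hxr]

theorem regular_limit (hl : IsSuccLimit l) (hcard : l.card ≤ Cardinal.aleph0)
    (H : ∀ γ < l, Regular S Ag γ) : Regular S Ag l where
  restr h _ hw := hw.isBiworld_restrict_limit hl h
  ext h _ hy := exists_extension_limit hl H h hy
  next w hw := ⟨limitSplit w, isBiworld_limitSplit hl hw, restrict_limitSplit hl hcard H hw _,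
    disj_limitSplit w⟩

end Limit

-- Regularity at all countable depths and the theorem.

theorem regular_of_card_le (β : Ordinal.{0}) (hβ : β.card ≤ Cardinal.aleph0) :
    Regular S Ag β := by
  induction β using WellFoundedLT.induction with
  | ind β ih =>
    have ih' : ∀ γ < β, Regular S Ag γ := fun γ hγ =>
      ih γ hγ ((Ordinal.card_le_card hγ.le).trans hβ)
    cases β using Ordinal.limitRecOn with
    | zero => exact regular_zero
    | add_one β => exact regular_succ fun γ hγ => ih' γ (lt_add_one_iff.2 hγ)
    | limit l hl => exact regular_limit hl hβ ih'

end Biworld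

theorem theorem1 {S : Type u} {Ag : Type v} (α μ' μ β : Ordinal.{0})
    (hα : α ≤ μ') (hμ' : μ' ≤ μ) (hμ : μ < β) (hβ : β.card ≤ Cardinal.aleph0)
    (w : Biworld.Raw S Ag μ) (hw : Biworld.IsBiworld w)
    (w' : Biworld.Raw S Ag μ') (hw' : Biworld.IsBiworld w') :
    Biworld.IsBiworld (Biworld.restrict (hα.trans hμ') w) ∧
    (Biworld.Completed w' → Biworld.LePrec w' w → Biworld.Completed w) ∧
    (∃ v : Biworld.Raw S Ag β,
      Biworld.IsBiworld v ∧ Biworld.Completed v ∧ Biworld.LePrec w v) ∧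
    (∀ (ν : Ordinal.{0}) (h : μ = ν + 1),
      Biworld.Completed w ↔
        ∀ A : Ag, Biworld.poss (h ▸ w : Biworld.Raw S Ag (ν + 1)) A ∩
            Biworld.imposs (h ▸ w : Biworld.Raw S Ag (ν + 1)) A = ∅) := by
  have H : ∀ γ ≤ β, Biworld.Regular S Ag γ := fun γ hγ =>
    Biworld.regular_of_card_le γ ((Ordinal.card_le_card hγ).trans hβ)
  have Hμ := H μ hμ.le
  refine ⟨Hμ.restr _ w hw, ?_, ?_, ?_⟩
  · rintro hc ⟨h, rfl⟩
    exact (H _ (hμ'.trans hμ.le)).completed Hμ h hw hc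
  -- Since `μ < β` there is room for one disjoint step, after which any extension to depth `β`
  -- inherits completedness.
  · obtain ⟨v, hv, rfl, hd⟩ := Hμ.next w hw
    have hle : μ + 1 ≤ β := Order.add_one_le_of_lt hμ
    obtain ⟨x, hx, rfl⟩ := (H β le_rfl).ext hle v hv
    exact ⟨x, hx, (H _ hle).completed (H β le_rfl) hle hx (hd.completed hv), hμ.le,
      (hx.isPrebiworld.restrict_restrict _ _).symm⟩
  · rintro ν rfl
    rw [← Biworld.disj_iff]
    exact ⟨fun hc => hc.disj (H ν (le_self_add.trans hμ.le)) (fun x hx => Hμ.restr _ x hx) hw,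
      fun hd => hd.completed hw⟩
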